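/- Let $G$ be a finite simple graph. A set $D\subseteq V(G)$ is a dominating set of $G$ if every vertex of $V(G)\setminus D$ is adjacent to at least one vertex of $D$. The TARS-graph $\varepsilon(G)$ is the simple graph whose vertices are the dominating sets of $G$, where two dominating sets $X$ and $Y$ are adjacent if and only if either (i) $Y$ can be obtained from $X$ by adding or deleting a single vertex of $G$, or (ii) there are vertices $u\in X$ and $v\in Y\setminus X$ that are adjacent in $G$ such that $Y=(X\cup\{v\})\setminus\{u\}$. A finite graph on $n$ vertices is pancyclic if it contains a cycle of length $\ell$ for every integer $\ell$ with $3\le \ell\le n$. Corollary (forests). If $F$ is a finite forest (a finite acyclic simple graph), then $\varepsilon(F)$ is pancyclic. -/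

import Mathlib

namespace SimpleGraph

variable {V : Type*}

/-- `S` is a dominating set of `G`: every vertex lies in `S` or has a neighbour in `S`. -/
def IsDominatingSet (G : SimpleGraph V) (S : Set V) : Prop :=
  ∀ w : V, w ∈ S ∨ ∃ s ∈ S, G.Adj w s

/-- Token addition/removal: `Y` arises from `X` by adding or deleting a single vertex. -/
def TokenAddRemove (X Y : Set V) : Prop :=
  (∃ v, v ∉ X ∧ Y = X ∪ {v}) ∨ (∃ v, v ∈ X ∧ Y = X \ {v})

/-- Token sliding: `Y` arises from `X` by moving one token along an edge of `G`. -/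
def TokenSlide (G : SimpleGraph V) (X Y : Set V) : Prop :=
  ∃ u ∈ X, ∃ v ∈ Y \ X, G.Adj u v ∧ Y = (X ∪ {v}) \ {u}

theorem TokenAddRemove.symm {X Y : Set V} (h : TokenAddRemove X Y) : TokenAddRemove Y X := by
  rcases h with ⟨v, hv, rfl⟩ | ⟨v, hv, rfl⟩
  · refine Or.inr ⟨v, Or.inr rfl, ?_⟩
    ext w
    by_cases hw : w = v
    · subst hw; simp [hv]
    · simp [hw]
  · refine Or.inl ⟨v, by simp, ?_⟩
    ext w
    by_cases hw : w = v
    · subst hw; simp [hv]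
    · simp [hw]

theorem TokenSlide.symm {G : SimpleGraph V} {X Y : Set V} (h : TokenSlide G X Y) :
    TokenSlide G Y X := by
  obtain ⟨u, hu, v, ⟨hvY, hvX⟩, huv, rfl⟩ := h
  refine ⟨v, hvY, u, ⟨hu, by simp⟩, huv.symm, ?_⟩
  ext w
  by_cases hw : w = u
  · subst hw; simp [hu, huv.ne]
  · by_cases hw' : w = v
    · subst hw'; simp [hvX, hw]
    · simp [hw, hw']

theorem TokenAddRemove.ne {X Y : Set V} (h : TokenAddRemove X Y) : X ≠ Y := by
  rintro rfl
  rcases h with ⟨v, hv, h⟩ | ⟨v, hv, h⟩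
  · exact hv (h ▸ Or.inr rfl)
  · rw [h] at hv
    exact hv.2 rfl

theorem TokenSlide.ne {G : SimpleGraph V} {X Y : Set V} (h : TokenSlide G X Y) : X ≠ Y := by
  rintro rfl
  obtain ⟨_, _, _, ⟨hv, hv'⟩, _⟩ := h
  exact hv' hv

/-- The TARS-graph of `G`: its vertices are the dominating sets of `G`, and two of them are adjacent
if they differ by a token addition/removal or by a token slide along an edge of `G`. -/
def tarsGraph (G : SimpleGraph V) : SimpleGraph {S : Set V // G.IsDominatingSet S} where
  Adj X Y := TokenAddRemove X.1 Y.1 ∨ TokenSlide G X.1 Y.1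
  symm := ⟨fun _ _ h => h.imp TokenAddRemove.symm TokenSlide.symm⟩
  loopless := ⟨fun _ h => h.elim (fun h => h.ne rfl) (fun h => h.ne rfl)⟩

/-- A finite graph on `n` vertices is pancyclic if it has a cycle of each length `3 ≤ ℓ ≤ n`. -/
def IsPancyclic [Finite V] (G : SimpleGraph V) : Prop :=
  ∀ ℓ : ℕ, 3 ≤ ℓ → ℓ ≤ Nat.card V → ∃ (v : V) (c : G.Walk v v), c.IsCycle ∧ c.length = ℓ

end SimpleGraph

/-!
Let `v` be a leaf of the forest `F`, let `u` be its neighbour and let `H` be `F` without the edges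
at `u`. Adding to a dominating set `D` of `F` the vertices that `D` does not dominate in `H` gives
a dominating set `b` of `H`. As `u` lies on no cycle of length three or four, the sets `D` that
lead to a given `b` form a cube with top `b`, obtained by deleting from `b` certain neighbours of
`u`, always including `v`, together with the extra vertex `b \ {u}`. This fibre has an odd number
of elements, and `b \ {v}`, `b` and `b \ {u}` form a triangle in it; as `b` moves along an edge of
`ε(H)`, each of the three moves along an edge of `ε(F)`.

By induction `ε(H)` has a Hamiltonian path with an odd number of vertices. Go out along this path
and return through the sets `b`. On the way out, traverse the fibres in pairs, from `b \ {v}` to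
`b \ {u}` in one and back in the next, by paths with any desired even number of vertices; the last
fibre, left over by this pairing, is where one turns round. This gives paths of all lengths
between the adjacent sets `b \ {v}` and `b` over the first vertex `b`. Closing them up gives the
cycles, and the longest one is a Hamiltonian path of `ε(F)`, as needed to continue the induction.
-/

namespace Tars

open SimpleGraph

variable {α β V : Type*}

section Paths

variable {G : SimpleGraph α} {a b c d : α} {A B : Set α} {m n : ℕ}

/-- There is a path from `a` to `b` on exactly `n` vertices, all of them in `A`. Counting vertices
rather than edges makes the counts of concatenated paths add up. -/
def HasPathOn (G : SimpleGraph α) (a b : α) (A : Set α) (n : ℕ) : Prop :=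
  ∃ p : G.Walk a b, p.IsPath ∧ p.length + 1 = n ∧ ∀ s ∈ p.support, s ∈ A

namespace HasPathOn

theorem mono (h : HasPathOn G a b A n) (hAB : A ⊆ B) : HasPathOn G a b B n := by
  obtain ⟨p, hp, hn, hA⟩ := h
  exact ⟨p, hp, hn, fun s hs => hAB (hA s hs)⟩

theorem map (h : HasPathOn G a b A n) {H : SimpleGraph β} (f : G →g H)
    (hf : Function.Injective f) : HasPathOn H (f a) (f b) (f '' A) n := by
  obtain ⟨p, hp, hn, hA⟩ := h
  refine ⟨p.map f, hp.map hf, by simpa using hn, fun s hs => ?_⟩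
  obtain ⟨t, ht, rfl⟩ := List.mem_map.1 (p.support_map f ▸ hs)
  exact ⟨t, hA t ht, rfl⟩

theorem induce {P : Set α} (h : HasPathOn G a b A n) (hAP : A ⊆ P) (ha : a ∈ P) (hb : b ∈ P) :
    HasPathOn (G.induce P) ⟨a, ha⟩ ⟨b, hb⟩ (Subtype.val ⁻¹' A) n := by
  obtain ⟨p, hp, hn, hA⟩ := h
  have hP : ∀ s ∈ p.support, s ∈ P := fun s hs => hAP (hA s hs)
  have hsupp := p.support_induce hP
  refine ⟨p.induce P hP, ?_, ?_, fun s hs => ?_⟩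
  · rw [Walk.isPath_def, hsupp]
    exact .of_map Subtype.val (by rw [List.attachWith_map_subtype_val]; exact hp.support_nodup)
  · rw [← Walk.length_support, hsupp, List.length_attachWith, Walk.length_support, hn]
  · rw [hsupp, List.mem_attachWith] at hs
    exact hA s hs

theorem singleton (G : SimpleGraph α) (a : α) : HasPathOn G a a {a} 1 :=
  ⟨.nil, by simp, by simp, by simp⟩

theorem symm (h : HasPathOn G a b A n) : HasPathOn G b a A n := by
  obtain ⟨p, hp, hn, hA⟩ := h
  exact ⟨p.reverse, hp.reverse, by simpa using hn, by simpa using hA⟩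

theorem append (h : HasPathOn G a b A n) (hbc : G.Adj b c) (h' : HasPathOn G c d B m)
    (hAB : Disjoint A B) : HasPathOn G a d (A ∪ B) (n + m) := by
  obtain ⟨p, hp, hn, hA⟩ := h
  obtain ⟨q, hq, hm, hB⟩ := h'
  have hsupp : (p.append (.cons hbc q)).support = p.support ++ q.support := by
    simp [Walk.support_append]
  refine ⟨p.append (.cons hbc q), ?_, ?_, fun s => ?_⟩
  · rw [Walk.isPath_def, hsupp, List.nodup_append']
    exact ⟨hp.support_nodup, hq.support_nodup,
      fun s hsp hsq => Set.disjoint_left.1 hAB (hA s hsp) (hB s hsq)⟩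
  · simp only [Walk.length_append, Walk.length_cons]
    omega
  · rw [hsupp, List.mem_append]
    exact Or.imp (hA s) (hB s)

theorem cons (hab : G.Adj a b) (h : HasPathOn G b c A n) (ha : a ∉ A) :
    HasPathOn G a c (insert a A) (n + 1) := by
  rw [add_comm, Set.insert_eq]
  exact (singleton G a).append hab h (Set.disjoint_singleton_left.2 ha)

theorem concat (h : HasPathOn G a b A n) (hbc : G.Adj b c) (hc : c ∉ A) :
    HasPathOn G a c (insert c A) (n + 1) :=
  (h.symm.cons hbc.symm hc).symm

theorem exists_isCycle (h : HasPathOn G a b A n) (hab : G.Adj a b) (hn : 3 ≤ n) :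
    ∃ (v : α) (p : G.Walk v v), p.IsCycle ∧ p.length = n := by
  obtain ⟨p, hp, hpn, -⟩ := h
  refine ⟨b, .cons hab.symm p, (p.cons_isCycle_iff hab.symm).2 ⟨hp, fun hmem => ?_⟩, hpn⟩
  have := hp.length_eq_one_of_mem_edges (Sym2.eq_swap ▸ hmem)
  omega

theorem exists_isHamiltonian [Finite α] [DecidableEq α]
    (h : HasPathOn G a b A (Nat.card α)) : ∃ p : G.Walk a b, p.IsHamiltonian := by
  have := Fintype.ofFinite α
  obtain ⟨p, hp, hpn, -⟩ := h
  rw [Nat.card_eq_fintype_card] at hpn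
  exact ⟨p, Walk.isHamiltonian_iff_isPath_and_length_eq.2 ⟨hp, by omega⟩⟩

end HasPathOn

end Paths

section Cube

theorem ncard_Icc_sdiff [Finite V] {b C : Set V} (hCb : C ⊆ b) :
    (Set.Icc (b \ C) b).ncard = 2 ^ C.ncard := by
  have himage : Set.Icc (b \ C) b = (b \ ·) '' 𝒫 C := by
    ext D
    refine ⟨fun hD => ⟨b \ D, by grind, by grind⟩, ?_⟩
    rintro ⟨E, hE, rfl⟩
    exact ⟨Set.sdiff_subset_sdiff_right hE, Set.sdiff_subset⟩
  have hinj : Set.InjOn (b \ ·) (𝒫 C) := Set.LeftInvOn.injOn (f₁' := (b \ ·)) fun D hD =>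
    Set.sdiff_sdiff_cancel_left (Set.Subset.trans hD hCb)
  rw [himage, hinj.ncard_image, Set.ncard_powerset]

theorem hasse_adj_sdiff_singleton {b : Set V} {a : V} (ha : a ∈ b) :
    (hasse (Set V)).Adj b (b \ {a}) :=
  Or.inr (Set.sdiff_singleton_covBy ha)

theorem hasPathOn_hasse_append {b C : Set V} {a c d e : V} {m n : ℕ} (hCb : C ⊆ b)
    (hc : c ∈ C) (hd : d ∈ C \ {c}) (he : e ∈ C \ {c})
    (hp : HasPathOn (hasse (Set V)) (b \ {a}) (b \ {d}) (Set.Ico (b \ (C \ {c})) b) m)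
    (hq : HasPathOn (hasse (Set V)) ((b \ {c}) \ {d}) ((b \ {c}) \ {e})
      (Set.Ico ((b \ {c}) \ (C \ {c})) (b \ {c})) n) :
    HasPathOn (hasse (Set V)) (b \ {a}) (b \ {c}) (Set.Ico (b \ C) b) (m + (n + 1)) := by
  have hcb : c ∈ b := hCb hc
  have hdown : (hasse (Set V)).Adj (b \ {d}) ((b \ {c}) \ {d}) := by
    rw [sdiff_right_comm]
    exact hasse_adj_sdiff_singleton ⟨hcb, Ne.symm hd.2⟩
  have heb : e ∈ b \ {c} := ⟨hCb he.1, he.2⟩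
  have hface : (b \ {c}) \ (C \ {c}) = b \ C := by grind
  have hlower := hq.concat (hasse_adj_sdiff_singleton heb).symm (by simp)
  rw [Set.Ico_insert_right Set.sdiff_subset, hface] at hlower
  have hdisj : Disjoint (Set.Ico (b \ (C \ {c})) b) (Set.Icc (b \ C) (b \ {c})) :=
    Set.disjoint_left.2 fun S hS hS' => (hS'.2 (hS.1 ⟨hcb, by simp⟩)).2 rfl
  refine (hp.append hdown hlower hdisj).mono (Set.union_subset ?_ ?_)
  · exact Set.Ico_subset_Ico_left (by grind)
  · exact Set.Icc_subset_Ico_right (Set.sdiff_singleton_ssubset.2 hcb)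

/-- The edge `{b \ {a}, b}` of the cube spanned by `C` below `b` lies on cycles of all even
lengths; the path is such a cycle without the vertex `b`. -/
theorem exists_hasPathOn_hasse {b C : Set V} {a : V} (ha : a ∈ C) (hCb : C ⊆ b) {n : ℕ}
    (hn : Odd n) (hn' : n < 2 ^ C.ncard) :
    ∃ c ∈ C, HasPathOn (hasse (Set V)) (b \ {a}) (b \ {c}) (Set.Ico (b \ C) b) n := by
  induction hk : C.ncard generalizing b C a n with
  | zero => grind
  | succ k ih =>
  rw [hk, pow_succ] at hn'
  obtain rfl | hn1 := eq_or_ne n 1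
  · have hmem : b \ {a} ∈ Set.Ico (b \ C) b :=
      ⟨by grind, Set.sdiff_singleton_ssubset.2 (hCb ha)⟩
    exact ⟨a, ha, (HasPathOn.singleton _ _).mono (Set.singleton_subset_iff.2 hmem)⟩
  have hk0 : k ≠ 0 := by grind
  obtain ⟨c, hc, hca⟩ := Set.exists_ne_of_one_lt_ncard (by omega : 1 < C.ncard) a
  have hC' : (C \ {c}).ncard = k := by rw [Set.ncard_sdiff_singleton_of_mem hc, hk]; rfl
  have ha' : a ∈ C \ {c} := ⟨ha, hca.symm⟩
  have hCb' : C \ {c} ⊆ b := Set.sdiff_subset.trans hCb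
  obtain hlt | hge := lt_or_ge n (2 ^ k)
  · obtain ⟨d, hd, hp⟩ := ih ha' hCb' hn (hC'.symm ▸ hlt) hC'
    exact ⟨d, hd.1, hp.mono (Set.Ico_subset_Ico_left (by grind))⟩
  have heven : Even (2 ^ k) := Nat.even_pow.2 ⟨even_two, hk0⟩
  have hpos : 0 < 2 ^ k := by positivity
  obtain ⟨d, hd, hp⟩ := ih ha' hCb' (n := 2 ^ k - 1) (by grind) (by rw [hC']; omega) hC'
  obtain ⟨e, he, hq⟩ := ih hd (Set.sdiff_subset_sdiff_left hCb) (n := n - 2 ^ k) (by grind)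
    (by rw [hC']; omega) hC'
  refine ⟨c, hc, ?_⟩
  rw [show n = 2 ^ k - 1 + (n - 2 ^ k + 1) by omega]
  exact hasPathOn_hasse_append hCb hc hd he hp hq

end Cube

section Ladder

theorem exists_even_even_add_add_two {M M' N n : ℕ} (hM : Odd M) (hM' : Odd M')
    (hM3 : 3 ≤ M) (hM3' : 3 ≤ M') (hN : 3 ≤ N) (hn : N + 4 < n) (hn' : n ≤ M + (M' + N)) :
    ∃ k l m, Even k ∧ Even l ∧ 2 ≤ m ∧ k ≠ 0 ∧ l ≠ 0 ∧ k + 1 ≤ M ∧ l + 1 ≤ M' ∧ m ≤ N ∧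
      k + l + m + 2 = n := by
  obtain ⟨e, m, he, heM, hm, hm', hen⟩ :
      ∃ e m, Even e ∧ e + 2 ≤ M + M' ∧ 2 ≤ m ∧ m ≤ N ∧ e + m + 2 = n := by
    obtain hr | hr := (n - N - 2).even_or_odd
    · exact ⟨n - N - 2, N, hr, by omega, by omega, le_rfl, by omega⟩
    · exact ⟨n - N - 1, N - 1, by grind, by grind, by omega, by omega, by omega⟩
  obtain hle | hlt := le_or_gt (e - 2) (M - 1)
  · exact ⟨e - 2, 2, m, by grind, even_two, hm, by grind, by omega, by omega, hM3', hm', by grind⟩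
  · exact ⟨M - 1, e - (M - 1), m, by grind, by grind, hm, by omega, by omega, by omega, by grind,
      hm', by omega⟩

variable {G : SimpleGraph α} {H : SimpleGraph β}

/-- A map `proj` between the vertex sets of `G` and `H` that allows a path of `H` to be lifted to
paths of `G` of all lengths: over each vertex `b` there is a triangle `x b`, `y b`, `z b`, moving
along the edges of `H`, and the rest of the fibre is traversed from `x b` to a common neighbour of
`y b` and `z b`. -/
structure LadderFibration (G : SimpleGraph α) (H : SimpleGraph β) where
  proj : α → β
  x : H →g G
  y : H →g G
  z : H →g G
  proj_x : ∀ b, proj (x b) = b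
  proj_y : ∀ b, proj (y b) = b
  proj_z : ∀ b, proj (z b) = b
  x_adj_y : ∀ b, G.Adj (x b) (y b)
  x_adj_z : ∀ b, G.Adj (x b) (z b)
  z_adj_y : ∀ b, G.Adj (z b) (y b)
  odd_ncard_fibre : ∀ b, Odd (proj ⁻¹' {b}).ncard
  exists_hasPathOn : ∀ b n, Odd n → n + 2 ≤ (proj ⁻¹' {b}).ncard →
    ∃ c, G.Adj c (y b) ∧ G.Adj c (z b) ∧ HasPathOn G (x b) c (proj ⁻¹' {b} \ {y b, z b}) n

namespace LadderFibration

variable (L : LadderFibration G H) {b b' : β} {B : Set β} {n : ℕ}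

theorem three_le_ncard_fibre [Finite α] (b : β) : 3 ≤ (L.proj ⁻¹' {b}).ncard := by
  have hsub : {L.x b, L.y b, L.z b} ⊆ L.proj ⁻¹' {b} := by
    rintro _ (rfl | rfl | rfl)
    exacts [L.proj_x b, L.proj_y b, L.proj_z b]
  have hcard : ({L.x b, L.y b, L.z b} : Set α).ncard = 3 := Set.ncard_eq_three.2
    ⟨_, _, _, (L.x_adj_y b).ne, (L.x_adj_z b).ne, (L.z_adj_y b).ne', rfl⟩
  exact hcard ▸ Set.ncard_le_ncard hsub

theorem hasPathOn_x_z (hn : Even n) (hn0 : n ≠ 0) (hn' : n + 1 ≤ (L.proj ⁻¹' {b}).ncard) :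
    HasPathOn G (L.x b) (L.z b) (L.proj ⁻¹' {b} \ {L.y b}) n := by
  obtain ⟨m, rfl⟩ := Nat.exists_eq_succ_of_ne_zero hn0
  obtain ⟨c, -, hcz, hp⟩ := L.exists_hasPathOn b m (by grind) hn'
  refine (hp.concat hcz (by simp)).mono (Set.insert_subset ?_ (by grind))
  exact ⟨L.proj_z b, (L.z_adj_y b).ne⟩

theorem hasPathOn_x_y (hn : 2 ≤ n) (hn' : n ≤ (L.proj ⁻¹' {b}).ncard) :
    HasPathOn G (L.x b) (L.y b) (L.proj ⁻¹' {b}) n := by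
  obtain ⟨m, rfl⟩ : ∃ m, n = m + 1 := ⟨n - 1, by omega⟩
  obtain hm | hm := m.even_or_odd
  · refine ((L.hasPathOn_x_z hm (by omega) hn').concat (L.z_adj_y b) (by simp)).mono ?_
    exact Set.insert_subset (L.proj_y b) Set.sdiff_subset
  · obtain ⟨c, hcy, -, hp⟩ := L.exists_hasPathOn b m hm
      (by have := L.odd_ncard_fibre b; grind)
    exact (hp.concat hcy (by simp)).mono (Set.insert_subset (L.proj_y b) Set.sdiff_subset)

theorem ncard_preimage_insert [Finite α] (hb : b ∉ B) :
    (L.proj ⁻¹' insert b B).ncard = (L.proj ⁻¹' {b}).ncard + (L.proj ⁻¹' B).ncard := by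
  rw [Set.insert_eq, Set.preimage_union, Set.ncard_union_eq]
  exact (Set.disjoint_singleton_left.2 hb).preimage L.proj

theorem hasPathOn_wrap (hbb' : H.Adj b b') (hb : b ∉ B)
    (h : HasPathOn G (L.x b') (L.y b') (L.proj ⁻¹' B) n) :
    HasPathOn G (L.x b) (L.y b) (L.proj ⁻¹' insert b B) (n + 2) := by
  have hx := L.proj_x b
  have hy := L.proj_y b
  refine ((h.cons (L.x.map_adj hbb') ?_).concat (L.y.map_adj hbb').symm ?_).mono ?_
  · rwa [Set.mem_preimage, hx]
  · have := (L.x_adj_y b).ne'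
    simp [hy, hb, this]
  · grind

theorem hasPathOn_wrap_of_forall [Finite α] {N : ℕ} (hbb' : H.Adj b b') (hb : b ∉ B)
    (h : ∀ n, 2 ≤ n → n ≤ N → HasPathOn G (L.x b') (L.y b') (L.proj ⁻¹' B) n)
    (hn : 2 ≤ n) (hn' : n ≤ N + 2) :
    HasPathOn G (L.x b) (L.y b) (L.proj ⁻¹' insert b B) n := by
  obtain hn3 | hn3 := le_or_gt n 3
  · exact (L.hasPathOn_x_y hn (hn3.trans (L.three_le_ncard_fibre b))).mono
      (Set.preimage_mono (by simp))
  · obtain ⟨m, rfl⟩ : ∃ m, n = m + 2 := ⟨n - 2, by omega⟩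
    exact L.hasPathOn_wrap hbb' hb (h m (by omega) (by omega))

/-- The path visits the fibres through
`x b ⇝ z b → z b' ⇝ x b' → x b'' ⇝ y b'' → y b' → y b`. -/
theorem hasPathOn_zigzag {b'' : β} {k l : ℕ} (hbb' : H.Adj b b') (hb'b'' : H.Adj b' b'')
    (hb : b ∉ B) (hb' : b' ∉ B)
    (hk : Even k) (hk0 : k ≠ 0) (hk' : k + 1 ≤ (L.proj ⁻¹' {b}).ncard)
    (hl : Even l) (hl0 : l ≠ 0) (hl' : l + 1 ≤ (L.proj ⁻¹' {b'}).ncard)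
    (h : HasPathOn G (L.x b'') (L.y b'') (L.proj ⁻¹' B) n) :
    HasPathOn G (L.x b) (L.y b) (L.proj ⁻¹' insert b (insert b' B)) (k + l + n + 2) := by
  have hne : b ≠ b' := hbb'.ne
  have hy := L.proj_y b
  have hy' := L.proj_y b'
  have hfibres : Disjoint (L.proj ⁻¹' {b} \ {L.y b}) (L.proj ⁻¹' {b'} \ {L.y b'}) := by grind
  have hrest : Disjoint (L.proj ⁻¹' {b} \ {L.y b} ∪ L.proj ⁻¹' {b'} \ {L.y b'})
      (L.proj ⁻¹' B) := by grind
  have hout := (L.hasPathOn_x_z hk hk0 hk').append (L.z.map_adj hbb')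
    (L.hasPathOn_x_z hl hl0 hl').symm hfibres
  have hturn := hout.append (L.x.map_adj hb'b'') h hrest
  have hback := (hturn.concat (L.y.map_adj hb'b'').symm (by grind)).concat
    (L.y.map_adj hbb').symm (by grind)
  exact hback.mono (by grind)

theorem hasPathOn_insert_insert [Finite α] {b'' : β} (hbb' : H.Adj b b') (hb'b'' : H.Adj b' b'')
    (hb : b ∉ insert b' B) (hb' : b' ∉ B) (hb'' : b'' ∈ B)
    (h : ∀ n, 2 ≤ n → n ≤ (L.proj ⁻¹' B).ncard →
      HasPathOn G (L.x b'') (L.y b'') (L.proj ⁻¹' B) n)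
    (hn : 2 ≤ n) (hn' : n ≤ (L.proj ⁻¹' insert b (insert b' B)).ncard) :
    HasPathOn G (L.x b) (L.y b) (L.proj ⁻¹' insert b (insert b' B)) n := by
  obtain hle | hlt := le_or_gt n ((L.proj ⁻¹' B).ncard + 4)
  · exact L.hasPathOn_wrap_of_forall hbb' hb
      (fun m => L.hasPathOn_wrap_of_forall hb'b'' hb' h) hn hle
  rw [L.ncard_preimage_insert hb, L.ncard_preimage_insert hb'] at hn'
  have hthree : 3 ≤ (L.proj ⁻¹' B).ncard := (L.three_le_ncard_fibre b'').trans
    (Set.ncard_le_ncard (Set.preimage_mono (Set.singleton_subset_iff.2 hb'')))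
  obtain ⟨k, l, m, hk, hl, hm, hk0, hl0, hk', hl', hm', rfl⟩ :=
    exists_even_even_add_add_two (L.odd_ncard_fibre b) (L.odd_ncard_fibre b')
      (L.three_le_ncard_fibre b) (L.three_le_ncard_fibre b') hthree hlt hn'
  exact L.hasPathOn_zigzag hbb' hb'b'' (fun hmem => hb (.inr hmem)) hb' hk hk0 hk' hl hl0 hl'
    (h m hm hm')

theorem hasPathOn_of_isPath [Finite α] {b t : β} : ∀ (p : H.Walk b t), p.IsPath →
    Even p.length → ∀ n, 2 ≤ n → n ≤ (L.proj ⁻¹' {s | s ∈ p.support}).ncard →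
    HasPathOn G (L.x b) (L.y b) (L.proj ⁻¹' {s | s ∈ p.support}) n
  | .nil, _, _, n, hn, hn' => by simpa using L.hasPathOn_x_y hn (by simpa using hn')
  | .cons _ .nil, _, heven, _, _, _ => by simp at heven
  | .cons (v := b') hbb' (.cons (v := b'') hb'b'' q), hp, heven, n, hn, hn' => by
    obtain ⟨hp', hb⟩ := (Walk.cons_isPath_iff ..).1 hp
    obtain ⟨hq, hb'⟩ := (Walk.cons_isPath_iff ..).1 hp'
    have hsupp : {s | s ∈ (Walk.cons hbb' (.cons hb'b'' q)).support} =
        insert b (insert b' {s | s ∈ q.support}) := by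
      ext; simp
    have heven' : Even q.length := by simpa [Nat.even_add_one] using heven
    rw [hsupp] at hn' ⊢
    exact L.hasPathOn_insert_insert hbb' hb'b'' (by simpa using hb) hb' q.start_mem_support
      (hasPathOn_of_isPath q hq heven') hn hn'

theorem finite_base [Finite α] (L : LadderFibration G H) : Finite β :=
  .of_surjective L.proj fun b => ⟨L.x b, L.proj_x b⟩

theorem three_le_card [Finite α] (L : LadderFibration G H) (b : β) : 3 ≤ Nat.card α :=
  (L.three_le_ncard_fibre b).trans (Set.ncard_le_card _)

theorem odd_card_iff [Finite α] (L : LadderFibration G H) :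
    Odd (Nat.card α) ↔ Odd (Nat.card β) := by
  have := Fintype.ofFinite α
  have := L.finite_base
  have := Fintype.ofFinite β
  have hsum : Nat.card α = ∑ b, (L.proj ⁻¹' {b}).ncard := by
    rw [← Nat.card_congr (Equiv.sigmaFiberEquiv L.proj), Nat.card_sigma]
    rfl
  rw [hsum, Finset.odd_sum_iff_odd_card_odd]
  simp [L.odd_ncard_fibre]

theorem exists_adj_hasPathOn [Finite α] (L : LadderFibration G H) {s t : β}
    (hodd : Odd (Nat.card β)) (h : HasPathOn H s t Set.univ (Nat.card β)) (hn : 2 ≤ n)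
    (hn' : n ≤ Nat.card α) :
    ∃ a b, G.Adj a b ∧ HasPathOn G a b Set.univ n := by
  classical
  have := L.finite_base
  have := Fintype.ofFinite β
  obtain ⟨p, hp⟩ := h.exists_isHamiltonian
  have hsupp : {b | b ∈ p.support} = Set.univ := Set.eq_univ_of_forall hp.mem_support
  have heven : Even p.length := by
    rw [hp.length_eq, ← Nat.card_eq_fintype_card]
    grind
  refine ⟨L.x s, L.y s, L.x_adj_y s, ?_⟩
  simpa [hsupp] using L.hasPathOn_of_isPath p hp.isPath heven n hn
    (by simpa [hsupp, Set.ncard_univ] using hn')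

end LadderFibration

end Ladder

section Domination

variable {G H : SimpleGraph V} {D D' b : Set V} {a c : V}

/-- `D` together with the vertices it does not dominate. -/
def completion (G : SimpleGraph V) (D : Set V) : Set V :=
  D ∪ {w | ∀ s ∈ D, ¬G.Adj w s}

theorem subset_completion (G : SimpleGraph V) (D : Set V) : D ⊆ completion G D :=
  Set.subset_union_left

theorem isDominatingSet_completion (G : SimpleGraph V) (D : Set V) :
    G.IsDominatingSet (completion G D) := fun w => by
  by_cases hw : ∃ s ∈ D, G.Adj w s
  · exact .inr (hw.imp fun s hs => ⟨.inl hs.1, hs.2⟩)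
  · exact .inl (.inr (by simpa using hw))

theorem completion_eq_self (hD : G.IsDominatingSet D) : completion G D = D :=
  Set.union_eq_left.2 fun w hw => (hD w).resolve_right fun ⟨s, hs, hws⟩ => hw s hs hws

theorem completion_subset_completion (hDD' : D ⊆ D') (hD' : D' ⊆ completion G D) :
    completion G D' ⊆ completion G D :=
  Set.union_subset hD' fun _ hw => .inr fun s hs => hw s (hDD' hs)

theorem mem_of_isIsolated (hb : G.IsDominatingSet b) (ha : G.IsIsolated a) : a ∈ b :=
  (hb a).resolve_right fun ⟨s, _, has⟩ => ha s has

theorem completion_sdiff_singleton (hb : G.IsDominatingSet b) (ha : G.IsIsolated a) :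
    completion G (b \ {a}) = b := by
  refine Set.Subset.antisymm (Set.union_subset Set.sdiff_subset fun w hw => ?_) fun w hw => ?_
  · refine (hb w).resolve_right fun ⟨s, hs, hws⟩ => hw s ⟨hs, ?_⟩ hws
    rintro rfl
    exact ha w hws.symm
  · obtain rfl | hwa := eq_or_ne w a
    · exact .inr fun s _ => ha s
    · exact .inl ⟨hw, hwa⟩

theorem isDominatingSet_mono (hHG : H ≤ G) (hD : H.IsDominatingSet D) : G.IsDominatingSet D :=
  fun w => (hD w).imp_right fun ⟨s, hs, hws⟩ => ⟨s, hs, hHG hws⟩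

theorem isDominatingSet_sdiff_singleton (hHG : H ≤ G) (ha : H.IsIsolated a) (hc : H.IsIsolated c)
    (hac : G.Adj a c) (hb : H.IsDominatingSet b) : G.IsDominatingSet (b \ {a}) := fun w => by
  obtain rfl | hwa := eq_or_ne w a
  · exact .inr ⟨c, ⟨mem_of_isIsolated hb hc, hac.ne'⟩, hac⟩
  · refine (hb w).imp (fun hw => ⟨hw, hwa⟩) fun ⟨s, hs, hws⟩ => ⟨s, ⟨hs, ?_⟩, hHG hws⟩
    rintro rfl
    exact ha w hws.symm

end Domination

section TarsGraph

variable {G H : SimpleGraph V} {X Y b : Set V} {a c : V}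

theorem tokenAddRemove_of_hasse_adj (h : (hasse (Set V)).Adj X Y) : TokenAddRemove X Y := by
  obtain h | h := h
  · obtain ⟨v, hv, rfl⟩ := h.exists_set_insert
    exact .inl ⟨v, hv, (Set.union_singleton).symm⟩
  · obtain ⟨v, hv, rfl⟩ := h.exists_set_sdiff_singleton
    exact .inr ⟨v, hv, rfl⟩

theorem tokenSlide_sdiff_singleton (hac : G.Adj a c) (ha : a ∈ b) (hc : c ∈ b) :
    TokenSlide G (b \ {c}) (b \ {a}) :=
  ⟨a, ⟨ha, hac.ne⟩, c, ⟨⟨hc, hac.ne'⟩, by simp⟩, hac, by grind⟩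

theorem tokenAddRemove_sdiff_singleton_of_mem (h : TokenAddRemove X Y) (hX : a ∈ X) (hY : a ∈ Y) :
    TokenAddRemove (X \ {a}) (Y \ {a}) := by
  obtain ⟨v, hv, rfl⟩ | ⟨v, hv, rfl⟩ := h
  · exact .inl ⟨v, by grind, by grind⟩
  · exact .inr ⟨v, by grind, by grind⟩

theorem tokenSlide_sdiff_singleton_of_mem (h : TokenSlide G X Y) (hX : a ∈ X) (hY : a ∈ Y) :
    TokenSlide G (X \ {a}) (Y \ {a}) := by
  obtain ⟨u, hu, v, hv, huv, rfl⟩ := h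
  exact ⟨u, by grind, v, by grind, huv, by grind⟩

theorem tokenSlide_mono (hHG : H ≤ G) (h : TokenSlide H X Y) : TokenSlide G X Y := by
  obtain ⟨u, hu, v, hv, huv, h⟩ := h
  exact ⟨u, hu, v, hv, hHG huv, h⟩

/-- The cube of subsets of `V`, restricted to dominating sets, maps into the TARS-graph. -/
def hasseHom (G : SimpleGraph V) :
    (hasse (Set V)).induce {S | G.IsDominatingSet S} →g G.tarsGraph where
  toFun S := ⟨S.1, S.2⟩
  map_rel' h := .inl (tokenAddRemove_of_hasse_adj h)

/-- The inclusion of TARS-graphs induced by adding edges to the underlying graph. -/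
def monoHom (hHG : H ≤ G) : H.tarsGraph →g G.tarsGraph where
  toFun S := ⟨S.1, isDominatingSet_mono hHG S.2⟩
  map_rel' h := h.imp_right (tokenSlide_mono hHG)

/-- The embedding `S ↦ S \ {a}` of TARS-graphs for a vertex `a` that is isolated in `H`, and
therefore in every `S`, and that is dominated in `G` by another such vertex `c`. -/
def deleteHom (hHG : H ≤ G) (ha : H.IsIsolated a) (hc : H.IsIsolated c) (hac : G.Adj a c) :
    H.tarsGraph →g G.tarsGraph where
  toFun S := ⟨S.1 \ {a}, isDominatingSet_sdiff_singleton hHG ha hc hac S.2⟩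
  map_rel' {S T} h :=
    have hS := mem_of_isIsolated S.2 ha
    have hT := mem_of_isIsolated T.2 ha
    h.imp (tokenAddRemove_sdiff_singleton_of_mem · hS hT)
      fun h => tokenSlide_mono hHG (tokenSlide_sdiff_singleton_of_mem h hS hT)

end TarsGraph

section Pendant

variable {F : SimpleGraph V} {D b : Set V} {u v w : V}

/-- `v` is a leaf with neighbour `u`, and `u` lies on no cycle of length three or four: a vertex
`w ≠ u` is reached from `u` by at most one path of length at most two. -/
structure IsPendant (F : SimpleGraph V) (u v : V) : Prop where
  adj_iff : ∀ w, F.Adj v w ↔ w = u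
  eq_of_adj : ∀ ⦃w a c⦄, w ≠ u → F.Adj u a → F.Adj u c → (w = a ∨ F.Adj w a) →
    (w = c ∨ F.Adj w c) → a = c

/-- The neighbours of `u` that can be removed from `b`, with `u` taking over their domination,
without changing the completion with respect to `F` without the edges at `u`. -/
def detachable (F : SimpleGraph V) (u : V) (b : Set V) : Set V :=
  {w ∈ b | F.Adj u w ∧ completion (F.deleteIncidenceSet u) (b \ {w}) = b}

theorem isIsolated_deleteIncidenceSet (F : SimpleGraph V) (u : V) :
    (F.deleteIncidenceSet u).IsIsolated u :=
  fun _ h => (deleteIncidenceSet_adj.1 h).2.1 rfl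

theorem detachable_subset : detachable F u b ⊆ b :=
  Set.sep_subset _ _

theorem not_adj_of_mem_detachable {s : V} (hw : w ∈ detachable F u b) (hs : s ∈ b) :
    ¬(F.deleteIncidenceSet u).Adj w s := fun hws =>
  (hw.2.2.superset hw.1).elim (fun hw' => hw'.2 rfl) fun hw' => hw' s ⟨hs, hws.ne'⟩ hws

theorem eq_or_adj_of_mem_completion (hD : F.IsDominatingSet D)
    (hw : w ∈ completion (F.deleteIncidenceSet u) D) (hwD : w ∉ D) :
    w = u ∨ u ∈ D ∧ F.Adj u w := by
  obtain ⟨s, hs, hws⟩ := (hD w).resolve_left hwD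
  by_contra! hne
  refine hw.resolve_left hwD s hs (deleteIncidenceSet_adj.2 ⟨hws, hne.1, ?_⟩)
  rintro rfl
  exact hne.2 hs hws.symm

theorem notMem_detachable : u ∉ detachable F u b :=
  fun h => F.irrefl h.2.1

/-- The completion, as a map of dominating sets of `F` to those of `F` without the edges at `u`. -/
def completionMap (F : SimpleGraph V) (u : V) (D : {S // F.IsDominatingSet S}) :
    {S // (F.deleteIncidenceSet u).IsDominatingSet S} :=
  ⟨completion (F.deleteIncidenceSet u) D, isDominatingSet_completion _ _⟩

namespace IsPendant

theorem adj (h : IsPendant F u v) : F.Adj v u :=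
  (h.adj_iff u).2 rfl

theorem isIsolated_leaf (h : IsPendant F u v) : (F.deleteIncidenceSet u).IsIsolated v :=
  fun w hw => (deleteIncidenceSet_adj.1 hw).2.2 ((h.adj_iff w).1 (deleteIncidenceSet_adj.1 hw).1)

theorem leaf_mem_detachable (h : IsPendant F u v)
    (hb : (F.deleteIncidenceSet u).IsDominatingSet b) : v ∈ detachable F u b :=
  ⟨mem_of_isIsolated hb h.isIsolated_leaf, h.adj.symm,
    completion_sdiff_singleton hb h.isIsolated_leaf⟩

theorem mem_detachable_of_mem_completion (h : IsPendant F u v) (hD : F.IsDominatingSet D)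
    (huD : u ∈ D) (hw : w ∈ completion (F.deleteIncidenceSet u) D) (hwD : w ∉ D) :
    w ∈ detachable F u (completion (F.deleteIncidenceSet u) D) := by
  have hadj : ∀ s ∈ completion (F.deleteIncidenceSet u) D, s ∉ D → F.Adj u s := fun s hs hsD =>
    (eq_or_adj_of_mem_completion hD hs hsD).elim (fun hsu => absurd huD (hsu ▸ hsD)) And.right
  refine ⟨hw, hadj w hw hwD, Set.Subset.antisymm ?_ fun s hs => ?_⟩
  · exact completion_subset_completion
      (fun s hs => ⟨subset_completion _ _ hs, ne_of_mem_of_not_mem hs hwD⟩) Set.sdiff_subset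
  · obtain rfl | hsw := eq_or_ne s w
    · refine .inr fun t ht hst => ?_
      by_cases htD : t ∈ D
      · exact hw.resolve_left hwD t htD hst
      · obtain ⟨hst, hsu, -⟩ := deleteIncidenceSet_adj.1 hst
        exact hst.ne (h.eq_of_adj hsu (hadj s hs hwD) (hadj t ht.1 htD) (.inl rfl) (.inr hst))
    · exact .inl ⟨hs, hsw⟩

theorem eq_or_mem_Icc (h : IsPendant F u v) (hD : F.IsDominatingSet D)
    (hDb : completion (F.deleteIncidenceSet u) D = b) :
    D = b \ {u} ∨ D ∈ Set.Icc (b \ detachable F u b) b := by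
  subst hDb
  by_cases huD : u ∈ D
  · exact .inr ⟨fun w hw => by_contra fun hwD =>
      hw.2 (h.mem_detachable_of_mem_completion hD huD hw.1 hwD), subset_completion _ _⟩
  · refine .inl (Set.Subset.antisymm (fun w hw => ?_) fun w hw => by_contra fun hwD => ?_)
    · exact ⟨subset_completion _ _ hw, ne_of_mem_of_not_mem hw huD⟩
    · exact (eq_or_adj_of_mem_completion hD hw.1 hwD).elim hw.2 fun hu => huD hu.1

theorem exists_adj_of_notMem (h : IsPendant F u v)
    (hb : (F.deleteIncidenceSet u).IsDominatingSet b) (hD : b \ detachable F u b ⊆ D)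
    (hw : w ∉ b) : ∃ s ∈ D, (F.deleteIncidenceSet u).Adj w s := by
  by_contra! hwD
  have hdet : ∀ s ∈ b, (F.deleteIncidenceSet u).Adj w s → s ∈ detachable F u b :=
    fun s hs hws => by_contra fun hs' => hwD s (hD ⟨hs, hs'⟩) hws
  obtain ⟨s, hs, hws⟩ := (hb w).resolve_left hw
  have hs' := hdet s hs hws
  obtain ⟨t, ht, hwt⟩ : ∃ t ∈ b \ {s}, (F.deleteIncidenceSet u).Adj w t := by
    by_contra! hall
    exact hw (hs'.2.2.subset (.inr hall))
  have ht' := hdet t ht.1 hwt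
  obtain ⟨hws, hwu, -⟩ := deleteIncidenceSet_adj.1 hws
  exact ht.2 (h.eq_of_adj hwu ht'.2.1 hs'.2.1 (.inr (deleteIncidenceSet_adj.1 hwt).1) (.inr hws))

theorem isDominatingSet_of_mem_Icc (h : IsPendant F u v)
    (hb : (F.deleteIncidenceSet u).IsDominatingSet b)
    (hD : D ∈ Set.Icc (b \ detachable F u b) b) : F.IsDominatingSet D := fun w => by
  have huD : u ∈ D :=
    hD.1 ⟨mem_of_isIsolated hb (isIsolated_deleteIncidenceSet F u), notMem_detachable⟩
  by_cases hw : w ∈ b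
  · by_cases hwC : w ∈ detachable F u b
    · exact .inr ⟨u, huD, hwC.2.1.symm⟩
    · exact .inl (hD.1 ⟨hw, hwC⟩)
  · exact .inr ((h.exists_adj_of_notMem hb hD.1 hw).imp fun s hs =>
      ⟨hs.1, deleteIncidenceSet_le F u hs.2⟩)

theorem completion_eq_of_mem_Icc (h : IsPendant F u v)
    (hb : (F.deleteIncidenceSet u).IsDominatingSet b)
    (hD : D ∈ Set.Icc (b \ detachable F u b) b) :
    completion (F.deleteIncidenceSet u) D = b := by
  refine Set.Subset.antisymm (Set.union_subset hD.2 fun w hw => by_contra fun hwb => ?_)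
    fun w hw => ?_
  · obtain ⟨s, hs, hws⟩ := h.exists_adj_of_notMem hb hD.1 hwb
    exact hw s hs hws
  · by_cases hwC : w ∈ detachable F u b
    · exact .inr fun s hs => not_adj_of_mem_detachable hwC (hD.2 hs)
    · exact .inl (hD.1 ⟨hw, hwC⟩)

theorem isDominatingSet_and_completion_eq_iff (h : IsPendant F u v)
    (hb : (F.deleteIncidenceSet u).IsDominatingSet b) :
    F.IsDominatingSet D ∧ completion (F.deleteIncidenceSet u) D = b ↔
      D ∈ insert (b \ {u}) (Set.Icc (b \ detachable F u b) b) := by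
  refine ⟨fun hD => h.eq_or_mem_Icc hD.1 hD.2, ?_⟩
  have hu := isIsolated_deleteIncidenceSet F u
  rintro (rfl | hD)
  · exact ⟨isDominatingSet_sdiff_singleton (deleteIncidenceSet_le F u) hu h.isIsolated_leaf
      h.adj.symm hb, completion_sdiff_singleton hb hu⟩
  · exact ⟨h.isDominatingSet_of_mem_Icc hb hD, h.completion_eq_of_mem_Icc hb hD⟩

theorem image_val_completionMap_fibre (h : IsPendant F u v)
    (b : {S // (F.deleteIncidenceSet u).IsDominatingSet S}) :
    Subtype.val '' (completionMap F u ⁻¹' {b}) =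
      insert (b.1 \ {u}) (Set.Icc (b.1 \ detachable F u b) b) := by
  ext D
  rw [← h.isDominatingSet_and_completion_eq_iff b.2]
  simp [completionMap, Subtype.ext_iff, and_comm]

theorem ncard_completionMap_fibre [Finite V] (h : IsPendant F u v)
    (b : {S // (F.deleteIncidenceSet u).IsDominatingSet S}) :
    (completionMap F u ⁻¹' {b}).ncard = 2 ^ (detachable F u b.1).ncard + 1 := by
  have hu := mem_of_isIsolated b.2 (isIsolated_deleteIncidenceSet F u)
  rw [← Set.ncard_image_of_injective _ Subtype.val_injective, h.image_val_completionMap_fibre,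
    Set.ncard_insert_of_notMem, ncard_Icc_sdiff detachable_subset]
  exact fun hmem => (hmem.1 ⟨hu, notMem_detachable⟩).2 rfl

theorem hasPathOn_completionMap_fibre (h : IsPendant F u v) {n : ℕ}
    (b : {S // (F.deleteIncidenceSet u).IsDominatingSet S}) {X Y : {S // F.IsDominatingSet S}}
    (hp : HasPathOn (hasse (Set V)) X.1 Y (Set.Ico (b.1 \ detachable F u b) b) n) :
    HasPathOn F.tarsGraph X Y
      {D | completionMap F u D = b ∧ D.1 ≠ b.1 ∧ D.1 ≠ b.1 \ {u}} n := by
  have hu := mem_of_isIsolated b.2 (isIsolated_deleteIncidenceSet F u)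
  have hsub : Set.Ico (b.1 \ detachable F u b) b ⊆ {S | F.IsDominatingSet S} := fun S hS =>
    h.isDominatingSet_of_mem_Icc b.2 (Set.Ico_subset_Icc_self hS)
  refine ((hp.induce hsub X.2 Y.2).map (hasseHom F) fun S T hST => ?_).mono ?_
  · exact Subtype.ext (congrArg Subtype.val hST)
  · rintro _ ⟨S, hS, rfl⟩
    refine ⟨Subtype.ext (h.completion_eq_of_mem_Icc b.2 (Set.Ico_subset_Icc_self hS)),
      hS.2.ne, fun hSu => ?_⟩
    exact (hSu.subset (hS.1 ⟨hu, notMem_detachable⟩)).2 rfl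

/-- The triangle over `b` is `b \ {v}`, `b`, `b \ {u}`. -/
noncomputable def ladderFibration [Finite V] (h : IsPendant F u v) :
    LadderFibration F.tarsGraph (F.deleteIncidenceSet u).tarsGraph where
  proj := completionMap F u
  x := deleteHom (deleteIncidenceSet_le F u) h.isIsolated_leaf
    (isIsolated_deleteIncidenceSet F u) h.adj
  y := monoHom (deleteIncidenceSet_le F u)
  z := deleteHom (deleteIncidenceSet_le F u) (isIsolated_deleteIncidenceSet F u)
    h.isIsolated_leaf h.adj.symm
  proj_x b := Subtype.ext (completion_sdiff_singleton b.2 h.isIsolated_leaf)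
  proj_y b := Subtype.ext (completion_eq_self b.2)
  proj_z b := Subtype.ext
    (completion_sdiff_singleton b.2 (isIsolated_deleteIncidenceSet F u))
  x_adj_y b := .inl (.symm (.inr ⟨v, mem_of_isIsolated b.2 h.isIsolated_leaf, rfl⟩))
  x_adj_z b := .inr (tokenSlide_sdiff_singleton h.adj.symm
    (mem_of_isIsolated b.2 (isIsolated_deleteIncidenceSet F u))
    (mem_of_isIsolated b.2 h.isIsolated_leaf))
  z_adj_y b := .inl (.symm (.inr
    ⟨u, mem_of_isIsolated b.2 (isIsolated_deleteIncidenceSet F u), rfl⟩))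
  odd_ncard_fibre b := by
    have hC : (detachable F u b.1).ncard ≠ 0 :=
      Set.ncard_ne_zero_of_mem (h.leaf_mem_detachable b.2)
    rw [h.ncard_completionMap_fibre]
    exact (even_two.pow_of_ne_zero hC).add_one
  exists_hasPathOn b n hn hn' := by
    rw [h.ncard_completionMap_fibre] at hn'
    obtain ⟨c, hc, hp⟩ := exists_hasPathOn_hasse (h.leaf_mem_detachable b.2) detachable_subset hn
      (by omega : n < _)
    have hu := mem_of_isIsolated b.2 (isIsolated_deleteIncidenceSet F u)
    have hcv : b.1 \ {c} ∈ Set.Icc (b.1 \ detachable F u b) b :=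
      ⟨Set.sdiff_subset_sdiff_right (Set.singleton_subset_iff.2 hc), Set.sdiff_subset⟩
    refine ⟨⟨_, h.isDominatingSet_of_mem_Icc b.2 hcv⟩, .inl (.symm (.inr ⟨c, hc.1, rfl⟩)),
      .inr (tokenSlide_sdiff_singleton hc.2.1 hu hc.1),
      (h.hasPathOn_completionMap_fibre b hp).mono fun D hD => ⟨hD.1, ?_⟩⟩
    rintro (rfl | rfl)
    exacts [hD.2.1 rfl, hD.2.2 rfl]

end IsPendant

end Pendant

section Forest

variable {F : SimpleGraph V} {a u v w : V}

theorem exists_path_snd_eq (hwu : w ≠ u) (hua : F.Adj u a) (hwa : w = a ∨ F.Adj w a) :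
    ∃ p : F.Path u w, p.1.snd = a := by
  obtain rfl | hwa := hwa
  · exact ⟨.singleton hua, rfl⟩
  · exact ⟨⟨.cons hua (.cons hwa.symm .nil), by simp [hua.ne, hwu.symm, hwa.ne']⟩, rfl⟩

theorem isPendant_of_isAcyclic (hF : F.IsAcyclic) (hv : ∀ w, F.Adj v w ↔ w = u) :
    IsPendant F u v where
  adj_iff := hv
  eq_of_adj w a c hwu hua huc hwa hwc := by
    obtain ⟨p, rfl⟩ := exists_path_snd_eq hwu hua hwa
    obtain ⟨q, rfl⟩ := exists_path_snd_eq hwu huc hwc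
    rw [(hF.subsingleton_path _ _).elim p q]

theorem exists_leaf [Finite V] (hF : F.IsAcyclic) (hne : F ≠ ⊥) :
    ∃ u v, ∀ w, F.Adj v w ↔ w = u := by
  obtain ⟨a, c, hac⟩ := ne_bot_iff_exists_adj.1 hne
  have : Nonempty V := ⟨a⟩
  obtain ⟨s, t, p, hp, hmax⟩ := Walk.exists_isPath_forall_isPath_length_le_length F
  have hnil : ¬p.Nil := fun hnil => by
    have := hmax _ _ hac.toWalk (by simp [hac.ne])
    simp [Walk.length_eq_zero_iff.2 hnil] at this
  refine ⟨p.penultimate, t, fun w => ⟨fun htw => ?_, ?_⟩⟩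
  · refine hF.eq_penultimate_of_adj_end hp htw (by_contra fun hws => ?_)
    have := hmax _ _ (p.concat htw) (hp.concat hws htw)
    simp at this
  · rintro rfl
    exact (p.adj_penultimate hnil).symm

theorem exists_isPendant [Finite V] (hF : F.IsAcyclic) (hne : F ≠ ⊥) :
    ∃ u v, IsPendant F u v := by
  obtain ⟨u, v, hv⟩ := exists_leaf hF hne
  exact ⟨u, v, isPendant_of_isAcyclic hF hv⟩

theorem isDominatingSet_bot_iff {S : Set V} :
    (⊥ : SimpleGraph V).IsDominatingSet S ↔ S = Set.univ := by
  simp [IsDominatingSet, Set.eq_univ_iff_forall]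

theorem card_isDominatingSet_bot :
    Nat.card {S : Set V // (⊥ : SimpleGraph V).IsDominatingSet S} = 1 := by
  simp [isDominatingSet_bot_iff]

theorem exists_hasPathOn_univ [Finite V] (F : SimpleGraph V) (hF : F.IsAcyclic) :
    Odd (Nat.card {S // F.IsDominatingSet S}) ∧
      ∃ s t, HasPathOn F.tarsGraph s t Set.univ (Nat.card {S // F.IsDominatingSet S}) := by
  induction F using WellFoundedLT.induction with
  | ind F ih =>
  obtain rfl | hne := eq_or_ne F ⊥
  · rw [card_isDominatingSet_bot]
    exact ⟨odd_one, ⟨_, isDominatingSet_bot_iff.2 rfl⟩, _,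
      (HasPathOn.singleton _ _).mono (Set.subset_univ _)⟩
  obtain ⟨u, v, h⟩ := exists_isPendant hF hne
  have hlt : F.deleteIncidenceSet u < F :=
    (deleteIncidenceSet_le F u).lt_of_not_ge fun hle => h.isIsolated_leaf u (hle h.adj)
  obtain ⟨hodd, s, t, hp⟩ := ih _ hlt (hF.anti hlt.le)
  refine ⟨h.ladderFibration.odd_card_iff.2 hodd, ?_⟩
  have hcard := h.ladderFibration.three_le_card s
  obtain ⟨X, Y, -, hXY⟩ := h.ladderFibration.exists_adj_hasPathOn hodd hp (by omega) le_rfl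
  exact ⟨X, Y, hXY⟩

end Forest

end Tars

theorem mainTheorem9 {V : Type*} [Finite V] (F : SimpleGraph V) (hF : F.IsAcyclic) :
    F.tarsGraph.IsPancyclic := by
  intro ℓ hℓ hℓ'
  obtain rfl | hne := eq_or_ne F ⊥
  · rw [Tars.card_isDominatingSet_bot] at hℓ'
    omega
  obtain ⟨u, v, h⟩ := Tars.exists_isPendant hF hne
  obtain ⟨hodd, s, t, hp⟩ := Tars.exists_hasPathOn_univ _ (hF.anti (F.deleteIncidenceSet_le u))
  obtain ⟨X, Y, hXY, hpath⟩ := h.ladderFibration.exists_adj_hasPathOn hodd hp (by omega) hℓ'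
  exact hpath.exists_isCycle hXY hℓ
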